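/- Let $h>0$, $p\in(0,1)$ and $1<\rho<2$. Let $\xi:[0,h]\to\mathbb{C}$ be of the form $\xi(t)=\xi_1(t)+\sqrt{t}\,\xi_2(t)$, $t\in[0,h]$, where $\xi_1$ and $\xi_2$ are (real) analytic on $[0,h]$. Let $\widetilde{\mathcal{E}}\subset\mathbb{C}$ be the ellipse with vertices $0$ and $2h$ and sum of half-axes $\rho h$, that is, $$\widetilde{\mathcal{E}}=\Big\{x+iy:\ \frac{(x-h)^2}{h^2}+\frac{y^2}{((\rho-1)h)^2}\le 1\Big\},$$ and suppose that $\xi$ extends analytically to $\widetilde{\mathcal{E}}$ in the sense that there is a holomorphic function on the interior of $\widetilde{\mathcal{E}}$ that coincides with $\xi$ on $(0,h]$ (the branch point $0$ of the square root lies on the boundary of the ellipse). Put $I(\xi)=\int_0^h\xi(t)\,dt$. For positive integers $N$ and $M$, let $t_0=0$ and $t_n=p^{n-1}h$ for $n=1,\dots,N+1$, let $\tau_1,\dots,\tau_M$ and $w_1,\dots,w_M$ be the points (the zeros of the Legendre polynomial of degree $M$) and the weights of the $M$-point Gauss–Legendre quadrature rule on $[-1,1]$, and let $$I_{N,M}(\xi)=\frac{p^Nh}{2}\,\xi(0)+\frac{p^Nh}{2}\,\xi(p^Nh)+\sum_{n=1}^N\frac{p^{n-1}h-p^nh}{2}\sum_{j=1}^M\xi\Big(\frac{p^{n-1}h-p^nh}{2}\,\tau_j+\frac{p^{n-1}h+p^nh}{2}\Big)w_j$$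 be the composite rule that uses the trapezoidal rule on $[0,t_{N+1}]$ and the $M$-point Gauss–Legendre rule on each interval $[t_{n+1},t_n]$, $n=1,\dots,N$. Then there is a constant $C>0$, independent of $N$ and $M$ (it may depend on $\xi$, $h$, $p$ and $\rho$), such that for all positive integers $N$ and $M$ $$|I(\xi)-I_{N,M}(\xi)|\le C\,N\left(\min\left\{\frac{1+\sqrt p}{1-\sqrt p},\ \sqrt{\frac{\rho}{2-\rho}}\right\}\right)^{-2M}+C\,(p^Nh)^{3/2}.$$ -/

import Mathlib

open Polynomial

noncomputable section

namespace GradedQuadrature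

/-- The (closed) ellipse with center `s + i t` and half axes `a`, `b` parallel to the coordinate
axes, as a subset of the complex plane. -/
def ellipse (s t a b : ℝ) : Set ℂ :=
  {z : ℂ | (z.re - s) ^ 2 / a ^ 2 + (z.im - t) ^ 2 / b ^ 2 ≤ 1}

/-- The ellipse with (real) vertices `a₁ < a₂` and sum of the half axes `r`: the center is
`(a₁ + a₂) / 2`, one half axis is `(a₂ - a₁) / 2`, the other one is `r - (a₂ - a₁) / 2`. -/
def vertexEllipse (a₁ a₂ r : ℝ) : Set ℂ :=
  ellipse ((a₁ + a₂) / 2) 0 ((a₂ - a₁) / 2) (r - (a₂ - a₁) / 2)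

/-- The Legendre polynomial of degree `M` on `[-1, 1]`, by Rodrigues' formula. -/
def legendre (M : ℕ) : ℝ[X] :=
  C (1 / ((2 : ℝ) ^ M * (M.factorial : ℝ))) * derivative^[M] ((X ^ 2 - 1) ^ M)

/-- The points of the `M`-point Gauss-Legendre rule on `[-1, 1]`: the zeros of the Legendre
polynomial of degree `M`. -/
def gaussNodes (M : ℕ) : Finset ℝ :=
  (legendre M).roots.toFinset

/-- The weight of the `M`-point Gauss-Legendre rule on `[-1, 1]` that belongs to the point `τ`: the
integral over `[-1, 1]` of the Lagrange basis polynomial that is `1` at `τ` and `0` at all the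
other points. -/
def gaussWeight (M : ℕ) (τ : ℝ) : ℝ :=
  ∫ x in (-1 : ℝ)..1, (Lagrange.basis (gaussNodes M) id τ).eval x

/-- The `M`-point Gauss-Legendre rule, transported to the interval `[a, b]`. -/
def gaussRule (M : ℕ) (a b : ℝ) (f : ℝ → ℂ) : ℂ :=
  (((b - a) / 2 : ℝ) : ℂ) *
    ∑ τ ∈ gaussNodes M, f ((b - a) / 2 * τ + (b + a) / 2) * (gaussWeight M τ : ℂ)

/-- The (one-panel) trapezoidal rule on the interval `[a, b]`. -/
def trapezoidalRule (a b : ℝ) (f : ℝ → ℂ) : ℂ :=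
  (((b - a) / 2 : ℝ) : ℂ) * f a + (((b - a) / 2 : ℝ) : ℂ) * f b

/-- The nodal points of the graded mesh: `t₀ = 0` and `tₙ = p ^ (n - 1) * h` for `n ≥ 1`. -/
def meshPoint (p h : ℝ) : ℕ → ℝ
  | 0 => 0
  | n + 1 => p ^ n * h

/-- The composite rule `I_{N,M}`: the trapezoidal rule on `J₀ = [t₀, t_{N+1}]` and the `M`-point
Gauss-Legendre rule on each of the intervals `Jₙ = [t_{n+1}, tₙ]`, `n = 1, …, N`. -/
def compositeRule (p h : ℝ) (N M : ℕ) (f : ℝ → ℂ) : ℂ :=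
  trapezoidalRule (meshPoint p h 0) (meshPoint p h (N + 1)) f +
    ∑ n ∈ Finset.Icc 1 N, gaussRule M (meshPoint p h (n + 1)) (meshPoint p h n) f

end GradedQuadrature

end

/-! Affine scaling carries the `M`-point Gauss rule on a panel to `[-1, 1]`. If the integrand is
holomorphic and bounded by `B` on the open Bernstein ellipse with parameter `R`, its Chebyshev
coefficients are at most `2 * B * R⁻¹ ^ n` (`exists_hasSum_chebyshev`). The rule integrates the
partial sum of degree below `2 * M` exactly and has nonnegative weights with sum `2`, so the error
is controlled by the tail, of order `R⁻¹ ^ (2 * M)` (`norm_integral_sub_gaussRule_le`).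

Every panel has the shape `[p * d, d]`, so one `R` serves them all. The two terms of the minimum are
exactly what is needed: `R ≤ (1 + √p) / (1 - √p)` keeps the panel's ellipse from passing the vertex
`0` (`one_sub_mul_add_inv_le`), and `R ^ 2 ≤ ρ / (2 - ρ)` keeps it no rounder than the given ellipse
(`joukowski_mem_openEllipse`). All panel ellipses then lie in one smaller ellipse touching the given
one only at `0`.

The extension need not be bounded on the given ellipse, but it is on the smaller one: away from `0`
by compactness (`exists_bound_openEllipse`), near `0` because it agrees there with a convergent
expression in `z` and the principal root of `z` (`exists_bound_near_zero`). On the remaining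
interval at `0`, `1/2`-Hölder continuity at `0` gives the power `3/2` for the trapezoidal rule. -/

noncomputable section

namespace GradedQuadrature

/-! ### Gauss-Legendre rule: orthogonality, nodes, exactness, positive weights -/

/-- The factor in front of the derivative in Rodrigues' formula is nonzero. -/
lemma rodrigues_const_ne_zero (M : ℕ) : 1 / ((2 : ℝ) ^ M * (M.factorial : ℝ)) ≠ 0 := by
  positivity

lemma integral_eval_C_mul (c : ℝ) (q : ℝ[X]) :
    ∫ x in (-1 : ℝ)..1, (C c * q).eval x = c * ∫ x in (-1 : ℝ)..1, q.eval x := by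
  simp [eval_mul]

/-- A factor `X ^ 2 - 1` survives fewer than `M` derivatives; this kills the boundary terms when
integrating by parts. -/
lemma eval_iterate_derivative_sq_sub_one_pow {M k : ℕ} (hk : k < M) {x : ℝ} (hx : x ^ 2 = 1) :
    (derivative^[k] ((X ^ 2 - 1 : ℝ[X]) ^ M)).eval x = 0 := by
  obtain ⟨r, hr⟩ := pow_sub_dvd_iterate_derivative_pow (X ^ 2 - 1 : ℝ[X]) M k
  rw [hr, eval_mul, eval_pow]
  simp [hx, Nat.sub_ne_zero_of_lt hk]

/-- Each integration by parts moves one derivative onto `q` and lowers the degree bound by one,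
until `q` is `0`. -/
lemma integral_iterate_derivative_mul_eq_zero (M : ℕ) : ∀ j ≤ M, ∀ q : ℝ[X], q.degree < j →
    ∫ x in (-1 : ℝ)..1, (derivative^[j] ((X ^ 2 - 1 : ℝ[X]) ^ M) * q).eval x = 0 := by
  intro j
  induction j with
  | zero =>
    intro _ q hq
    have : q = 0 := by
      rw [← degree_eq_bot]
      simpa using hq
    simp [this]
  | succ j ih =>
    intro hj q hq
    set G := derivative^[j] ((X ^ 2 - 1 : ℝ[X]) ^ M) with hG
    have hI : ∫ x in (-1 : ℝ)..1, (derivative (G * q)).eval x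
        = (G * q).eval 1 - (G * q).eval (-1) :=
      intervalIntegral.integral_eq_sub_of_hasDerivAt (fun x _ => (G * q).hasDerivAt x)
        ((derivative (G * q)).continuous.intervalIntegrable _ _)
    have h1 : G.eval 1 = 0 := eval_iterate_derivative_sq_sub_one_pow hj (by norm_num)
    have h2 : G.eval (-1) = 0 := eval_iterate_derivative_sq_sub_one_pow hj (by norm_num)
    have hq' : (derivative q).degree < j := by
      rcases eq_or_ne q 0 with rfl | hq0
      · simp
      · refine (degree_derivative_lt hq0).trans_le ?_
        rw [degree_eq_natDegree hq0] at hq ⊢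
        norm_cast at hq ⊢
        omega
    have h3 := ih (by omega) (derivative q) hq'
    rw [derivative_mul] at hI
    simp only [eval_add] at hI
    rw [intervalIntegral.integral_add ((derivative G * q).continuous.intervalIntegrable _ _)
      ((G * derivative q).continuous.intervalIntegrable _ _), h3] at hI
    rw [Function.iterate_succ_apply', ← hG]
    simpa [h1, h2] using hI

lemma integral_legendre_mul_eq_zero {M : ℕ} {q : ℝ[X]} (hq : q.degree < M) :
    ∫ x in (-1 : ℝ)..1, (legendre M * q).eval x = 0 := by
  rw [legendre, mul_assoc, integral_eval_C_mul,
    integral_iterate_derivative_mul_eq_zero M M le_rfl q hq, mul_zero]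

lemma natDegree_sq_sub_one_pow (M : ℕ) : ((X ^ 2 - 1 : ℝ[X]) ^ M).natDegree = 2 * M := by
  rw [natDegree_pow, show (X ^ 2 - 1 : ℝ[X]) = X ^ 2 - C 1 by simp, natDegree_X_pow_sub_C,
    mul_comm]

/-- Rolle's theorem with multiplicities: each derivative loses at most one real root. -/
lemma card_roots_sub_le_card_roots_iterate_derivative (q : ℝ[X]) (k : ℕ) :
    Multiset.card q.roots ≤ Multiset.card (derivative^[k] q).roots + k := by
  induction k with
  | zero => simp
  | succ k ih =>
    rw [Function.iterate_succ_apply']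
    have := card_roots_le_derivative (derivative^[k] q)
    omega

lemma card_roots_sq_sub_one_pow (M : ℕ) :
    Multiset.card ((X ^ 2 - 1 : ℝ[X]) ^ M).roots = 2 * M := by
  have h : (X ^ 2 - 1 : ℝ[X]) = (X - C 1) * (X - C (-1)) := by
    simp only [map_neg, map_one]
    ring
  rw [roots_pow, h, roots_mul (mul_ne_zero (X_sub_C_ne_zero _) (X_sub_C_ne_zero _)),
    roots_X_sub_C, roots_X_sub_C]
  simp [mul_comm]

lemma natDegree_legendre_le (M : ℕ) : (legendre M).natDegree ≤ M := by
  refine (natDegree_C_mul_le _ _).trans ((natDegree_iterate_derivative _ _).trans ?_)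
  rw [natDegree_sq_sub_one_pow]
  omega

lemma card_roots_legendre_ge (M : ℕ) : M ≤ Multiset.card (legendre M).roots := by
  have h := card_roots_sub_le_card_roots_iterate_derivative ((X ^ 2 - 1 : ℝ[X]) ^ M) M
  rw [card_roots_sq_sub_one_pow] at h
  rw [legendre, roots_C_mul _ (rodrigues_const_ne_zero M)]
  omega

lemma natDegree_legendre (M : ℕ) : (legendre M).natDegree = M :=
  (natDegree_legendre_le M).antisymm ((card_roots_legendre_ge M).trans (card_roots' _))

lemma card_roots_legendre (M : ℕ) : Multiset.card (legendre M).roots = M :=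
  ((card_roots' _).trans (natDegree_legendre_le M)).antisymm (card_roots_legendre_ge M)

/-- The root count does not exclude the zero polynomial when `M = 0`, so the coefficient at `M` is
computed instead. -/
lemma legendre_ne_zero (M : ℕ) : legendre M ≠ 0 := by
  have hm : ((X ^ 2 - 1 : ℝ[X]) ^ M).Monic := by
    refine Monic.pow ?_ M
    simpa using monic_X_pow_sub_C (1 : ℝ) two_ne_zero
  refine mul_ne_zero (C_ne_zero.2 (rodrigues_const_ne_zero M)) fun h0 => ?_
  have h := coeff_iterate_derivative (k := M) ((X ^ 2 - 1 : ℝ[X]) ^ M) M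
  rw [h0, coeff_zero, ← two_mul, ← natDegree_sq_sub_one_pow M, hm.coeff_natDegree,
    natDegree_sq_sub_one_pow] at h
  have : (2 * M).descFactorial M ≠ 0 := by
    rw [Ne, Nat.descFactorial_eq_zero_iff_lt]
    omega
  simp only [nsmul_eq_mul, mul_one] at h
  exact this (by exact_mod_cast h.symm)

lemma eq_zero_of_integral_nonneg_eq_zero {q : ℝ[X]}
    (hq : ∀ x ∈ Set.Ioo (-1 : ℝ) 1, 0 ≤ q.eval x)
    (hi : ∫ x in (-1 : ℝ)..1, q.eval x = 0) : q = 0 := by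
  have hcl : ∀ x ∈ Set.Icc (-1 : ℝ) 1, 0 ≤ q.eval x := by
    intro x hx
    have : closure (Set.Ioo (-1 : ℝ) 1) ⊆ {x | 0 ≤ q.eval x} :=
      closure_minimal hq (isClosed_le continuous_const q.continuous)
    rw [closure_Ioo (by norm_num)] at this
    exact this hx
  by_contra hne
  refine (intervalIntegral.integral_pos (a := -1) (b := 1) (by norm_num) q.continuousOn
    (fun x hx => hcl x (Set.Ioc_subset_Icc_self hx)) ?_).ne' hi
  by_contra! hall
  refine hne (eq_zero_of_infinite_isRoot q ((Set.Icc_infinite (show (-1 : ℝ) < 1 by norm_num)).mono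
    fun x hx => le_antisymm (hall x hx) (hcl x hx)))

/-- The Legendre polynomial of degree `M` has no factor of positive degree that does not change
sign on `(-1, 1)`. -/
lemma false_of_legendre_eq_mul {M : ℕ} {u s : ℝ[X]} (h : legendre M = u * s)
    (hu : 0 < u.natDegree) (hsign : ∀ x ∈ Set.Ioo (-1 : ℝ) 1, 0 ≤ u.eval x) : False := by
  have h0 : u * s ≠ 0 := h ▸ legendre_ne_zero M
  have hs : s ≠ 0 := right_ne_zero_of_mul h0
  have hd := natDegree_legendre M
  rw [h, natDegree_mul (left_ne_zero_of_mul h0) hs] at hd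
  have hdeg : s.degree < M := by
    rw [degree_eq_natDegree hs]
    norm_cast
    omega
  -- The product `u * s * s` is nonnegative on the interval, yet its integral vanishes by
  -- orthogonality to `s`.
  refine mul_ne_zero h0 hs (eq_zero_of_integral_nonneg_eq_zero (fun x hx => ?_)
    (h ▸ integral_legendre_mul_eq_zero hdeg))
  rw [eval_mul, eval_mul, mul_assoc]
  exact mul_nonneg (hsign x hx) (mul_self_nonneg _)

lemma mem_gaussNodes {M : ℕ} {τ : ℝ} : τ ∈ gaussNodes M ↔ (legendre M).IsRoot τ := by
  rw [gaussNodes, Multiset.mem_toFinset, mem_roots (legendre_ne_zero M)]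

/-- A root outside the interval would split off a linear factor of constant sign on it. -/
lemma gaussNodes_mem_Ioo {M : ℕ} {τ : ℝ} (hτ : τ ∈ gaussNodes M) : τ ∈ Set.Ioo (-1 : ℝ) 1 := by
  obtain ⟨s, hs⟩ := dvd_iff_isRoot.2 (mem_gaussNodes.1 hτ)
  by_contra hout
  rw [Set.mem_Ioo, not_and_or, not_lt, not_lt] at hout
  rcases hout with h | h
  · refine false_of_legendre_eq_mul hs (by simp) fun x hx => ?_
    simp only [eval_sub, eval_X, eval_C]
    linarith [hx.1]
  · refine false_of_legendre_eq_mul (u := C τ - X) (s := -s) (by rw [hs]; ring) ?_ fun x hx => ?_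
    · rw [← neg_sub, natDegree_neg]
      simp
    · simp only [eval_sub, eval_X, eval_C]
      linarith [hx.2]

/-- A double root would split off a square, which does not change sign; hence all roots are simple.
-/
lemma card_gaussNodes (M : ℕ) : (gaussNodes M).card = M := by
  have hnd : (legendre M).roots.Nodup := by
    refine Multiset.nodup_iff_count_le_one.2 fun a => ?_
    by_contra! hlt
    rw [count_roots] at hlt
    obtain ⟨s, hs⟩ := (le_rootMultiplicity_iff (legendre_ne_zero M)).1 hlt
    refine false_of_legendre_eq_mul hs (by simp [natDegree_pow]) fun x _ => ?_
    rw [eval_pow]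
    exact sq_nonneg _
  rw [gaussNodes, Multiset.toFinset_card_of_nodup hnd, card_roots_legendre]

lemma integral_eq_sum_gaussWeight_of_degree_lt {M : ℕ} {q : ℝ[X]} (hq : q.degree < M) :
    ∫ x in (-1 : ℝ)..1, q.eval x = ∑ τ ∈ gaussNodes M, q.eval τ * gaussWeight M τ := by
  have hinj : Set.InjOn (id : ℝ → ℝ) (gaussNodes M) := Function.injective_id.injOn
  have h := Lagrange.eq_interpolate hinj (by rwa [card_gaussNodes] : q.degree < (gaussNodes M).card)
  conv_lhs => rw [h]
  simp only [Lagrange.interpolate_apply, eval_finsetSum, eval_mul, eval_C, id]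
  have hint : ∀ τ ∈ gaussNodes M, IntervalIntegrable (fun x => q.eval τ *
      (Lagrange.basis (gaussNodes M) id τ).eval x) MeasureTheory.volume (-1) 1 := fun τ _ =>
    (continuous_const.mul (Polynomial.continuous _)).intervalIntegrable _ _
  rw [intervalIntegral.integral_finsetSum hint]
  simp only [intervalIntegral.integral_const_mul, gaussWeight]

/-- The `M`-point Gauss-Legendre rule is exact for polynomials of degree less than `2 * M`. -/
lemma integral_eq_sum_gaussWeight {M : ℕ} {q : ℝ[X]} (hq : q.degree < (2 * M : ℕ)) :
    ∫ x in (-1 : ℝ)..1, q.eval x = ∑ τ ∈ gaussNodes M, q.eval τ * gaussWeight M τ := by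
  have hP := legendre_ne_zero M
  have hdP : (legendre M).degree = M := by rw [degree_eq_natDegree hP, natDegree_legendre]
  -- Division by the Legendre polynomial: the multiple vanishes at the nodes and, its quotient
  -- having degree below `M`, integrates to `0`. Only the remainder matters.
  have hmod : (q % legendre M).degree < M := hdP ▸ EuclideanDomain.mod_lt q hP
  have hsplit : q = legendre M * (q / legendre M) + q % legendre M :=
    (EuclideanDomain.div_add_mod q (legendre M)).symm
  have hdiv : (q / legendre M).degree < M := by
    rcases eq_or_ne (q / legendre M) 0 with h0 | h0
    · rw [h0, degree_zero]
      exact WithBot.bot_lt_coe M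
    · have hle : (legendre M).degree ≤ q.degree := by
        by_contra! hlt
        exact h0 ((Polynomial.div_eq_zero_iff hP).2 hlt)
      have h := degree_add_div hP hle
      have hq0 : q ≠ 0 := by
        rintro rfl
        simp at h0
      rw [hdP, degree_eq_natDegree h0, degree_eq_natDegree hq0] at h
      rw [degree_eq_natDegree hq0] at hq
      rw [degree_eq_natDegree h0]
      norm_cast at *
      omega
  have heval : ∀ τ ∈ gaussNodes M, q.eval τ = (q % legendre M).eval τ := by
    intro τ hτ
    have h0 : (legendre M).eval τ = 0 := mem_gaussNodes.1 hτ
    conv_lhs => rw [hsplit]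
    simp [h0]
  rw [Finset.sum_congr rfl fun τ hτ => by rw [heval τ hτ],
    ← integral_eq_sum_gaussWeight_of_degree_lt hmod]
  conv_lhs => rw [hsplit]
  simp only [eval_add]
  rw [intervalIntegral.integral_add ((Polynomial.continuous _).intervalIntegrable _ _)
    ((Polynomial.continuous _).intervalIntegrable _ _), integral_legendre_mul_eq_zero hdiv, zero_add]

/-- The square of the Lagrange basis polynomial has degree `2 * M - 2`, so the rule is exact for it
and returns this weight as the integral of a square. -/
lemma gaussWeight_nonneg {M : ℕ} {τ : ℝ} (hτ : τ ∈ gaussNodes M) : 0 ≤ gaussWeight M τ := by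
  have hinj : Set.InjOn (id : ℝ → ℝ) (gaussNodes M) := Function.injective_id.injOn
  set ℓ := Lagrange.basis (gaussNodes M) id τ with hℓ
  have hM : 0 < M := by
    rw [← card_gaussNodes M]
    exact Finset.card_pos.2 ⟨τ, hτ⟩
  have hdeg : (ℓ ^ 2).degree < (2 * M : ℕ) := by
    refine degree_le_natDegree.trans_lt (Nat.cast_lt.2 ?_)
    rw [natDegree_pow, Lagrange.natDegree_basis hinj hτ, card_gaussNodes]
    omega
  have h := integral_eq_sum_gaussWeight hdeg
  rw [Finset.sum_eq_single_of_mem τ hτ fun σ hσ hne => ?_, eval_pow] at h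
  · have h1 : ℓ.eval τ = 1 := Lagrange.eval_basis_self hinj hτ
    rw [h1, one_pow, one_mul] at h
    rw [← h]
    refine intervalIntegral.integral_nonneg (by norm_num) fun x _ => ?_
    rw [eval_pow]
    positivity
  · have h0 : ℓ.eval σ = 0 := Lagrange.eval_basis_of_ne (v := id) hne.symm hσ
    rw [eval_pow, h0]
    simp

lemma sum_gaussWeight {M : ℕ} (hM : 1 ≤ M) : ∑ τ ∈ gaussNodes M, gaussWeight M τ = 2 := by
  have h := integral_eq_sum_gaussWeight (M := M) (q := 1)
    (by rw [degree_one]; exact_mod_cast (by omega : 0 < 2 * M))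
  simp only [eval_one, one_mul, intervalIntegral.integral_const, smul_eq_mul] at h
  rw [← h]
  norm_num

/-! ### Chebyshev series by Fourier series in the angle -/

/-- The restriction of `f` to `[-1, 1]`, seen as a function of the angle `t` by `x = cos t`. -/
def angleMap (f : ℂ → ℂ) (t : AddCircle (2 * Real.pi)) : ℂ :=
  f (((AddCircle.toCircle t : ℂ) + (AddCircle.toCircle t : ℂ)⁻¹) / 2)

lemma angleMap_neg (f : ℂ → ℂ) (t : AddCircle (2 * Real.pi)) :
    angleMap f (-t) = angleMap f t := by
  simp only [angleMap, AddCircle.toCircle_neg, Circle.coe_inv, inv_inv]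
  rw [add_comm]

lemma coe_toCircle_two_pi (θ : ℝ) :
    ((AddCircle.toCircle (θ : AddCircle (2 * Real.pi)) : Circle) : ℂ) = Complex.exp (θ * Complex.I) := by
  have h : (2 * Real.pi) ≠ 0 := by positivity
  rw [AddCircle.toCircle_apply_mk, Circle.coe_exp, div_self h, one_mul]

lemma angleMap_coe (f : ℂ → ℂ) (θ : ℝ) :
    angleMap f (θ : AddCircle (2 * Real.pi)) = f (Real.cos θ : ℝ) := by
  rw [angleMap, coe_toCircle_two_pi, ← Complex.exp_neg, Complex.ofReal_cos, Complex.cos, neg_mul]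

lemma continuous_angleMap {f : ℂ → ℂ} {R : ℝ}
    (hd : ∀ w : ℂ, R⁻¹ < ‖w‖ → ‖w‖ < R → DifferentiableAt ℂ f ((w + w⁻¹) / 2)) (hR : 1 < R) :
    Continuous (angleMap f) := by
  refine continuous_iff_continuousAt.2 fun t => ?_
  have hn : ‖(AddCircle.toCircle t : ℂ)‖ = 1 := Circle.norm_coe _
  have h := hd (AddCircle.toCircle t : ℂ) (by rw [hn]; exact inv_lt_one_of_one_lt₀ hR)
    (by rw [hn]; exact hR)
  have hc : Continuous fun t : AddCircle (2 * Real.pi) => (AddCircle.toCircle t : ℂ) :=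
    continuous_subtype_val.comp AddCircle.continuous_toCircle
  exact ContinuousAt.comp (f := fun t : AddCircle (2 * Real.pi) =>
      ((AddCircle.toCircle t : ℂ) + (AddCircle.toCircle t : ℂ)⁻¹) / 2) h.continuousAt
    ((hc.add (hc.inv₀ fun t => Circle.coe_ne_zero _)).div_const 2).continuousAt

section
variable [Fact (0 < 2 * Real.pi)]

lemma fourierCoeff_angleMap_neg (f : ℂ → ℂ) (n : ℤ) :
    fourierCoeff (angleMap f) (-n) = fourierCoeff (angleMap f) n := by
  rw [fourierCoeff, ← MeasureTheory.integral_neg_eq_self, fourierCoeff]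
  refine MeasureTheory.integral_congr_ae (Filter.Eventually.of_forall fun t => ?_)
  simp only [angleMap_neg]
  congr 1
  simp [fourier_apply]

lemma fourierCoeff_angleMap_eq_circleIntegral (f : ℂ → ℂ) (n : ℕ) :
    fourierCoeff (angleMap f) n = (2 * Real.pi * Complex.I : ℂ)⁻¹ •
      ∮ z in C(0, 1), (z - 0)⁻¹ • (z⁻¹ ^ n * f ((z + z⁻¹) / 2)) := by
  rw [fourierCoeff_eq_intervalIntegral _ _ 0, zero_add, circleIntegral,
    ← intervalIntegral.integral_smul, ← intervalIntegral.integral_smul]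
  refine intervalIntegral.integral_congr fun θ _ => ?_
  have hpi : (Real.pi : ℂ) ≠ 0 := by exact_mod_cast Real.pi_ne_zero
  have hc : circleMap 0 1 θ = Complex.exp (θ * Complex.I) := by simp [circleMap]
  have hf : (fourier (-(n : ℤ)) (θ : AddCircle (2 * Real.pi)) : ℂ)
      = (Complex.exp (θ * Complex.I))⁻¹ ^ n := by
    rw [fourier_apply, AddCircle.toCircle_zsmul, Circle.coe_zpow, coe_toCircle_two_pi, zpow_neg,
      zpow_natCast, inv_pow]
  simp only [deriv_circleMap, sub_zero]
  rw [hc, hf, angleMap, coe_toCircle_two_pi]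
  simp only [smul_eq_mul, Complex.real_smul]
  have he := Complex.exp_ne_zero (θ * Complex.I)
  push_cast
  field_simp

variable {f : ℂ → ℂ} {R B : ℝ}

/-- The integrand is holomorphic on the annulus, so the unit circle can be moved to any radius `s <
R`, where `z⁻¹ ^ n` is small. The hypotheses stop short of the circle of radius `R`, hence the limit
`s → R`. -/
lemma norm_fourierCoeff_angleMap_le
    (hd : ∀ w : ℂ, R⁻¹ < ‖w‖ → ‖w‖ < R → DifferentiableAt ℂ f ((w + w⁻¹) / 2))
    (hB : ∀ w : ℂ, R⁻¹ < ‖w‖ → ‖w‖ < R → ‖f ((w + w⁻¹) / 2)‖ ≤ B) (hR : 1 < R) (n : ℕ) :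
    ‖fourierCoeff (angleMap f) n‖ ≤ B * R⁻¹ ^ n := by
  have hR1 : R⁻¹ < 1 := inv_lt_one_of_one_lt₀ hR
  have key : ∀ s ∈ Set.Ioo 1 R, ‖fourierCoeff (angleMap f) n‖ ≤ B * s⁻¹ ^ n := by
    intro s hs
    have hs0 : 0 < s := zero_lt_one.trans hs.1
    have hdiff : ∀ z : ℂ, 1 ≤ ‖z‖ → ‖z‖ ≤ s →
        DifferentiableAt ℂ (fun z : ℂ => z⁻¹ ^ n * f ((z + z⁻¹) / 2)) z := by
      intro z h1 h2
      have hz : z ≠ 0 := norm_pos_iff.1 (by linarith)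
      have h3 := hd z (by linarith) (by linarith [hs.2])
      have h4 : DifferentiableAt ℂ (fun z : ℂ => (z + z⁻¹) / 2) z :=
        (differentiableAt_id.add (differentiableAt_inv hz)).div_const 2
      exact ((differentiableAt_inv hz).pow n).mul (DifferentiableAt.comp z h3 h4)
    have hdef := Complex.circleIntegral_sub_center_inv_smul_eq_of_differentiable_on_annulus_off_countable
      (c := 0) (r := 1) (R := s) (f := fun z : ℂ => z⁻¹ ^ n * f ((z + z⁻¹) / 2)) (s := ∅)
      one_pos hs.1.le Set.countable_empty
      (fun z hz => (hdiff z (by simpa using hz.2) (by simpa using hz.1)).continuousAt.continuousWithinAt)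
      (fun z hz => hdiff z (le_of_lt (by simpa using hz.1.2)) (le_of_lt (by simpa using hz.1.1)))
    rw [fourierCoeff_angleMap_eq_circleIntegral, ← hdef]
    have hbd := circleIntegral.norm_two_pi_i_inv_smul_integral_le_of_norm_le_const (c := 0)
      (f := fun z : ℂ => (z - 0)⁻¹ • (z⁻¹ ^ n * f ((z + z⁻¹) / 2)))
      (C := s⁻¹ * (s⁻¹ ^ n * B)) hs0.le fun z hz => by
        have hz' : ‖z‖ = s := by simpa using hz
        rw [norm_smul, norm_mul, norm_pow, norm_inv, norm_inv, sub_zero, hz']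
        have := hB z (by rw [hz']; linarith [hs.1]) (by rw [hz']; exact hs.2)
        gcongr
    refine hbd.trans_eq ?_
    field_simp
  have hlim : Filter.Tendsto (fun s : ℝ => B * s⁻¹ ^ n) (nhdsWithin R (Set.Ioo 1 R))
      (nhds (B * R⁻¹ ^ n)) := by
    have : ContinuousAt (fun s : ℝ => B * s⁻¹ ^ n) R :=
      continuousAt_const.mul ((continuousAt_inv₀ (by linarith)).pow n)
    exact this.tendsto.mono_left nhdsWithin_le_nhds
  have : (nhdsWithin R (Set.Ioo 1 R)).NeBot := by
    rw [← mem_closure_iff_nhdsWithin_neBot, closure_Ioo hR.ne]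
    exact Set.right_mem_Icc.2 hR.le
  exact ge_of_tendsto hlim (eventually_mem_nhdsWithin.mono key)

end

/-- The Chebyshev series of a function that is holomorphic and bounded on an open Bernstein
ellipse. -/
theorem exists_hasSum_chebyshev {f : ℂ → ℂ} {R B : ℝ}
    (hd : ∀ w : ℂ, R⁻¹ < ‖w‖ → ‖w‖ < R → DifferentiableAt ℂ f ((w + w⁻¹) / 2))
    (hB : ∀ w : ℂ, R⁻¹ < ‖w‖ → ‖w‖ < R → ‖f ((w + w⁻¹) / 2)‖ ≤ B) (hR : 1 < R) :
    ∃ a : ℕ → ℂ, (∀ n, ‖a n‖ ≤ 2 * B * R⁻¹ ^ n) ∧ ∀ x ∈ Set.Icc (-1 : ℝ) 1,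
      HasSum (fun n : ℕ => a n * ((Chebyshev.T ℝ n).eval x : ℝ)) (f x) := by
  have : Fact (0 < 2 * Real.pi) := ⟨Real.two_pi_pos⟩
  have hR0 : 0 ≤ R⁻¹ := by positivity
  have hR1 : R⁻¹ < 1 := inv_lt_one_of_one_lt₀ hR
  set F : C(AddCircle (2 * Real.pi), ℂ) := ⟨angleMap f, continuous_angleMap hd hR⟩ with hF
  set c : ℕ → ℂ := fun n => fourierCoeff (angleMap f) n with hc
  have hle : ∀ n, ‖c n‖ ≤ B * R⁻¹ ^ n := norm_fourierCoeff_angleMap_le hd hB hR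
  have hsc : Summable c := Summable.of_norm_bounded
    ((summable_geometric_of_lt_one hR0 hR1).mul_left B) hle
  have hs : Summable (fourierCoeff F) := by
    refine Summable.of_nat_of_neg hsc ?_
    simpa only [hF, ContinuousMap.coe_mk, fourierCoeff_angleMap_neg] using hsc
  refine ⟨fun n => (if n = 0 then 1 else 2) * c n, fun n => ?_, fun x hx => ?_⟩
  · have h2 : ‖(if n = 0 then 1 else 2 : ℂ)‖ ≤ 2 := by split_ifs <;> norm_num
    rw [norm_mul, mul_assoc]
    exact mul_le_mul h2 (hle n) (norm_nonneg _) zero_le_two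
  · set θ := Real.arccos x
    have hx' : Real.cos θ = x := Real.cos_arccos hx.1 hx.2
    have h := (has_pointwise_sum_fourier_series_of_summable hs
      (θ : AddCircle (2 * Real.pi))).nat_add_neg
    have hT : ∀ n : ℕ, fourierCoeff F n • (fourier (n : ℤ) (θ : AddCircle (2 * Real.pi)) : ℂ)
        + fourierCoeff F (-(n : ℤ)) • (fourier (-(n : ℤ)) (θ : AddCircle (2 * Real.pi)) : ℂ)
        = 2 * c n * ((Chebyshev.T ℝ n).eval x : ℝ) := by
      intro n
      have h1 : fourierCoeff F (-(n : ℤ)) = c n := fourierCoeff_angleMap_neg f n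
      have h2 : fourierCoeff F n = c n := rfl
      have h3 : ((fourier (n : ℤ) (θ : AddCircle (2 * Real.pi)) : ℂ) +
          (fourier (-(n : ℤ)) (θ : AddCircle (2 * Real.pi)) : ℂ)) = 2 * Complex.cos (n * θ) := by
        simp only [fourier_apply, AddCircle.toCircle_zsmul, Circle.coe_zpow, coe_toCircle_two_pi,
          ← Complex.exp_int_mul, Complex.cos]
        push_cast
        ring_nf
      rw [h1, h2, smul_eq_mul, smul_eq_mul, ← mul_add, h3, ← hx', Chebyshev.T_real_cos]
      push_cast
      ring
    simp only [hT] at h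
    -- Pairing `n` with `-n` counts the index `0` twice; one copy is removed, so `a 0` carries the
    -- factor `1` instead of `2`.
    have h0 := hasSum_ite_eq (0 : ℕ) (c 0)
    have hsub := h.sub h0
    have hv : F (θ : AddCircle (2 * Real.pi)) = f x := by
      rw [← hx']
      exact angleMap_coe f θ
    have hz : fourierCoeff F 0 • (fourier 0 (θ : AddCircle (2 * Real.pi)) : ℂ) = c 0 := by
      simp [hc, hF]
    rw [hv, hz, add_sub_cancel_right] at hsub
    have hterm : (fun n : ℕ => (if n = 0 then 1 else 2) * c n * ((Chebyshev.T ℝ n).eval x : ℝ)) =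
        fun n : ℕ => 2 * c n * ((Chebyshev.T ℝ n).eval x : ℝ) - if n = 0 then c 0 else 0 := by
      funext n
      rcases eq_or_ne n 0 with rfl | hn
      · simp
        ring
      · simp [hn]
    rw [hterm]
    exact hsub

/-! ### Error of the Gauss rule for holomorphic integrands -/

/-- The Gauss-Legendre rule on `[-1, 1]` for a function with a fast converging Chebyshev series. -/
theorem norm_integral_sub_gauss_le {M : ℕ} (hM : 1 ≤ M) {g : ℝ → ℂ} {a : ℕ → ℂ} {D r : ℝ}
    (hr0 : 0 ≤ r) (hr1 : r < 1) (ha : ∀ n, ‖a n‖ ≤ D * r ^ n)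
    (hg : ContinuousOn g (Set.Icc (-1) 1))
    (hs : ∀ x ∈ Set.Icc (-1 : ℝ) 1,
      HasSum (fun n : ℕ => a n * ((Chebyshev.T ℝ n).eval x : ℝ)) (g x)) :
    ‖(∫ x in (-1 : ℝ)..1, g x) - ∑ τ ∈ gaussNodes M, g τ * (gaussWeight M τ : ℂ)‖ ≤
      4 * (D * r ^ (2 * M) / (1 - r)) := by
  set δ := D * r ^ (2 * M) / (1 - r) with hδ
  -- The partial sum of degree below `2 * M` is the longest for which exactness is available.
  set S : ℝ → ℂ := fun x => ∑ n ∈ Finset.range (2 * M), a n * ((Chebyshev.T ℝ n).eval x : ℝ)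
    with hS
  have hScont : Continuous S := continuous_finsetSum _ fun n _ =>
    continuous_const.mul (Complex.continuous_ofReal.comp (Polynomial.continuous _))
  have hclose : ∀ x ∈ Set.Icc (-1 : ℝ) 1, ‖g x - S x‖ ≤ δ := by
    intro x hx
    have h := (hasSum_nat_add_iff' (2 * M)).2 (hs x hx)
    rw [hS, ← h.tsum_eq]
    have hgeo := ((hasSum_geometric_of_lt_one hr0 hr1).mul_left (D * r ^ (2 * M)))
    refine tsum_of_norm_bounded hgeo fun n => ?_
    have hT : ‖(((Chebyshev.T ℝ (n + 2 * M : ℕ)).eval x : ℝ) : ℂ)‖ ≤ 1 := by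
      rw [Complex.norm_real]
      exact Chebyshev.abs_eval_T_real_le_one _ (abs_le.2 hx)
    rw [norm_mul]
    calc _ ≤ ‖a (n + 2 * M)‖ * 1 := by gcongr
      _ ≤ D * r ^ (n + 2 * M) := by simpa using ha (n + 2 * M)
      _ = _ := by ring
  have hexact : ∫ x in (-1 : ℝ)..1, S x = ∑ τ ∈ gaussNodes M, S τ * (gaussWeight M τ : ℂ) := by
    have hint : ∀ n ∈ Finset.range (2 * M), IntervalIntegrable
        (fun x : ℝ => a n * ((Chebyshev.T ℝ n).eval x : ℝ)) MeasureTheory.volume (-1) 1 :=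
      fun n _ => (continuous_const.mul
        (Complex.continuous_ofReal.comp (Polynomial.continuous _))).intervalIntegrable _ _
    simp only [hS, Finset.sum_mul]
    rw [intervalIntegral.integral_finsetSum hint, Finset.sum_comm]
    refine Finset.sum_congr rfl fun n hn => ?_
    rw [intervalIntegral.integral_const_mul, intervalIntegral.integral_ofReal,
      integral_eq_sum_gaussWeight (M := M) ?_]
    · push_cast
      rw [Finset.mul_sum]
      exact Finset.sum_congr rfl fun τ _ => by ring
    · rw [Chebyshev.degree_T, Int.natAbs_natCast]
      exact_mod_cast Finset.mem_range.1 hn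
  have hgi : IntervalIntegrable g MeasureTheory.volume (-1) 1 :=
    ContinuousOn.intervalIntegrable (by rwa [Set.uIcc_of_le (by norm_num)])
  have hsplit : (∫ x in (-1 : ℝ)..1, g x) - ∑ τ ∈ gaussNodes M, g τ * (gaussWeight M τ : ℂ) =
      (∫ x in (-1 : ℝ)..1, (g x - S x)) -
        ∑ τ ∈ gaussNodes M, (g τ - S τ) * (gaussWeight M τ : ℂ) := by
    rw [intervalIntegral.integral_sub hgi (hScont.intervalIntegrable _ _), hexact]
    simp only [sub_mul, Finset.sum_sub_distrib]
    ring
  have h1 : ‖∫ x in (-1 : ℝ)..1, (g x - S x)‖ ≤ δ * 2 := by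
    refine (intervalIntegral.norm_integral_le_of_norm_le_const fun x hx => hclose x ?_).trans_eq ?_
    · rw [Set.uIoc_of_le (by norm_num)] at hx
      exact Set.Ioc_subset_Icc_self hx
    · norm_num
  have h2 : ‖∑ τ ∈ gaussNodes M, (g τ - S τ) * (gaussWeight M τ : ℂ)‖ ≤ δ * 2 := by
    rw [← sum_gaussWeight hM, Finset.mul_sum]
    refine norm_sum_le_of_le _ fun τ hτ => ?_
    rw [norm_mul, Complex.norm_real, Real.norm_of_nonneg (gaussWeight_nonneg hτ)]
    exact mul_le_mul_of_nonneg_right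
      (hclose τ (Set.Ioo_subset_Icc_self (gaussNodes_mem_Ioo hτ))) (gaussWeight_nonneg hτ)
  rw [hsplit]
  refine (norm_sub_le _ _).trans ?_
  linarith

/-- The error of the Gauss-Legendre rule on `[a, b]` for a function that is holomorphic and bounded
on the open Bernstein ellipse with parameter `R`. -/
theorem norm_integral_sub_gaussRule_le {M : ℕ} (hM : 1 ≤ M) {a b R B : ℝ} (hab : a ≤ b)
    {f : ℝ → ℂ} {F : ℂ → ℂ} (hf : ContinuousOn f (Set.Icc a b))
    (hF : ∀ t ∈ Set.Icc a b, F t = f t) (hR : 1 < R)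
    (hd : ∀ w : ℂ, R⁻¹ < ‖w‖ → ‖w‖ < R → DifferentiableAt ℂ F
      (((b - a) / 2 : ℝ) * ((w + w⁻¹) / 2) + ((b + a) / 2 : ℝ)))
    (hB : ∀ w : ℂ, R⁻¹ < ‖w‖ → ‖w‖ < R →
      ‖F (((b - a) / 2 : ℝ) * ((w + w⁻¹) / 2) + ((b + a) / 2 : ℝ))‖ ≤ B) :
    ‖(∫ t in a..b, f t) - gaussRule M a b f‖ ≤
      (b - a) / 2 * (4 * (2 * B * R⁻¹ ^ (2 * M) / (1 - R⁻¹))) := by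
  obtain ⟨c, hc, hsum⟩ := exists_hasSum_chebyshev
    (f := fun z => F (((b - a) / 2 : ℝ) * z + ((b + a) / 2 : ℝ)))
    (fun w h1 h2 => DifferentiableAt.fun_comp' _ (hd w h1 h2) (by fun_prop)) hB hR
  have hmem : ∀ x ∈ Set.Icc (-1 : ℝ) 1, (b - a) / 2 * x + (b + a) / 2 ∈ Set.Icc a b := by
    intro x hx
    constructor <;> nlinarith [hx.1, hx.2]
  have hg : ContinuousOn (fun x : ℝ => f ((b - a) / 2 * x + (b + a) / 2)) (Set.Icc (-1) 1) :=
    hf.comp (by fun_prop) hmem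
  have h := norm_integral_sub_gauss_le hM (by positivity) (inv_lt_one_of_one_lt₀ hR) hc hg
    fun x hx => by
      have h1 := hsum x hx
      rw [← hF _ (hmem x hx)]
      exact_mod_cast h1
  have hI := intervalIntegral.smul_integral_comp_mul_add (a := -1) (b := 1) f ((b - a) / 2)
    ((b + a) / 2)
  rw [show (b - a) / 2 * -1 + (b + a) / 2 = a by ring,
    show (b - a) / 2 * 1 + (b + a) / 2 = b by ring] at hI
  rw [← hI, gaussRule, Complex.real_smul, ← mul_sub, norm_mul, Complex.norm_real,
    Real.norm_of_nonneg (by linarith)]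
  exact mul_le_mul_of_nonneg_left h (by linarith)

/-! ### Ellipses with vertex `0` and the Joukowski map -/

/-- The open ellipse with vertices `0` and `2 * c`, in which `κ` is the ratio of the half axes. -/
def openEllipse (κ c : ℝ) : Set ℂ := {z : ℂ | z.re ^ 2 + (z.im / κ) ^ 2 < 2 * c * z.re}

lemma isOpen_openEllipse (κ c : ℝ) : IsOpen (openEllipse κ c) :=
  isOpen_lt (by fun_prop) (by fun_prop)

lemma openEllipse_re_pos {κ c : ℝ} (hc : 0 < c) {z : ℂ} (hz : z ∈ openEllipse κ c) : 0 < z.re := by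
  have hz' : z.re ^ 2 + (z.im / κ) ^ 2 < 2 * c * z.re := hz
  by_contra! h
  nlinarith [sq_nonneg z.re, sq_nonneg (z.im / κ)]

lemma openEllipse_mono {κ c d : ℝ} (hc : 0 < c) (hcd : c ≤ d) :
    openEllipse κ c ⊆ openEllipse κ d := by
  intro z hz
  have h := openEllipse_re_pos hc hz
  have hz' : z.re ^ 2 + (z.im / κ) ^ 2 < 2 * c * z.re := hz
  show z.re ^ 2 + (z.im / κ) ^ 2 < 2 * d * z.re
  nlinarith

lemma convex_openEllipse (κ c : ℝ) : Convex ℝ (openEllipse κ c) := by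
  intro z hz w hw a b ha hb hab
  have hz' : z.re ^ 2 + (z.im / κ) ^ 2 < 2 * c * z.re := hz
  have hw' : w.re ^ 2 + (w.im / κ) ^ 2 < 2 * c * w.re := hw
  show (a • z + b • w).re ^ 2 + ((a • z + b • w).im / κ) ^ 2 < 2 * c * (a • z + b • w).re
  simp only [Complex.add_re, Complex.add_im, Complex.smul_re, Complex.smul_im, smul_eq_mul]
  obtain rfl : b = 1 - a := by linarith
  rw [add_div, mul_div_assoc, mul_div_assoc]
  set y := z.im / κ
  set v := w.im / κ
  have h1 : 0 ≤ a * (1 - a) * ((z.re - w.re) ^ 2 + (y - v) ^ 2) := by positivity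
  rcases ha.eq_or_lt with rfl | ha
  · simpa using hw'
  · nlinarith [mul_lt_mul_of_pos_left hz' ha, mul_le_mul_of_nonneg_left hw'.le hb]

lemma openEllipse_subset_interior_vertexEllipse {h ρ : ℝ} (hh : 0 < h) (hρ : 1 < ρ) :
    openEllipse (ρ - 1) h ⊆ interior (vertexEllipse 0 (2 * h) (ρ * h)) := by
  refine interior_maximal (fun z hz => ?_) (isOpen_openEllipse _ _)
  have hz' : z.re ^ 2 + (z.im / (ρ - 1)) ^ 2 < 2 * h * z.re := hz
  show (z.re - (0 + 2 * h) / 2) ^ 2 / ((2 * h - 0) / 2) ^ 2 +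
    (z.im - 0) ^ 2 / (ρ * h - (2 * h - 0) / 2) ^ 2 ≤ 1
  have hρ' : ρ - 1 ≠ 0 := by linarith
  have e : (z.re - (0 + 2 * h) / 2) ^ 2 / ((2 * h - 0) / 2) ^ 2 +
      (z.im - 0) ^ 2 / (ρ * h - (2 * h - 0) / 2) ^ 2 =
      ((z.re - h) ^ 2 + (z.im / (ρ - 1)) ^ 2) / h ^ 2 := by
    rw [show ρ * h - (2 * h - 0) / 2 = (ρ - 1) * h by ring]
    field_simp
    ring
  rw [e, div_le_one (by positivity)]
  nlinarith

/-- The image of an annulus under the Joukowski map, scaled and translated, lies in an ellipse with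
vertex `0`. -/
lemma joukowski_mem_openEllipse {R ρ l c : ℝ} (hρ1 : 1 < ρ) (hρ2 : ρ < 2) (hR : 1 < R)
    (hRρ : R ^ 2 ≤ ρ / (2 - ρ)) (hl : 0 < l) (hlc : l * ((R + R⁻¹) / 2) ≤ c) {w : ℂ}
    (h1 : R⁻¹ < ‖w‖) (h2 : ‖w‖ < R) :
    (l : ℂ) * ((w + w⁻¹) / 2) + (c : ℂ) ∈ openEllipse (ρ - 1) c := by
  have hR0 : 0 < R := by linarith
  set s := ‖w‖ with hs
  have hs0 : 0 < s := lt_trans (by positivity) h1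
  have hsq : w.re ^ 2 + w.im ^ 2 = s ^ 2 := by
    rw [hs, Complex.sq_norm, Complex.normSq_apply]
    ring
  have hre : ((l : ℂ) * ((w + w⁻¹) / 2) + (c : ℂ)).re = l * (w.re / s * ((s + s⁻¹) / 2)) + c := by
    have : ((w + w⁻¹) / 2).re = w.re / s * ((s + s⁻¹) / 2) := by
      rw [show ((w + w⁻¹) / 2) = ((2⁻¹ : ℝ) : ℂ) * (w + w⁻¹) by push_cast; ring,
        Complex.re_ofReal_mul, Complex.add_re, Complex.inv_re, Complex.normSq_eq_norm_sq, ← hs]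
      field_simp
    rw [Complex.add_re, Complex.re_ofReal_mul, this, Complex.ofReal_re]
  have him : ((l : ℂ) * ((w + w⁻¹) / 2) + (c : ℂ)).im = l * (w.im / s * ((s - s⁻¹) / 2)) := by
    have : ((w + w⁻¹) / 2).im = w.im / s * ((s - s⁻¹) / 2) := by
      rw [show ((w + w⁻¹) / 2) = ((2⁻¹ : ℝ) : ℂ) * (w + w⁻¹) by push_cast; ring,
        Complex.im_ofReal_mul, Complex.add_im, Complex.inv_im, Complex.normSq_eq_norm_sq, ← hs]
      field_simp
      ring
    rw [Complex.add_im, Complex.im_ofReal_mul, this, Complex.ofReal_im, add_zero]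
  set A := (s + s⁻¹) / 2 with hA
  have hA0 : 0 < A := by positivity
  have hAlt : l * A < c := by
    refine lt_of_lt_of_le (mul_lt_mul_of_pos_left ?_ hl) hlc
    -- This product equals `R + R⁻¹ - (s + s⁻¹)`: on the annulus the horizontal half axis is below
    -- its value at `R`.
    have h3 : 0 < (R - s) * (1 - R⁻¹ * s⁻¹) := by
      refine mul_pos (by linarith) ?_
      have h4 : R⁻¹ * s⁻¹ < s * s⁻¹ := mul_lt_mul_of_pos_right h1 (by positivity)
      rw [mul_inv_cancel₀ hs0.ne'] at h4
      linarith
    have h5 : (R - s) * (1 - R⁻¹ * s⁻¹) = R + R⁻¹ - (s + s⁻¹) := by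
      field_simp
      ring
    linarith
  have hs2 : s ^ 2 * (2 - ρ) ≤ ρ := by
    rw [le_div_iff₀ (by linarith)] at hRρ
    nlinarith [pow_le_pow_left₀ hs0.le h2.le 2]
  have hs2' : 2 - ρ ≤ ρ * s ^ 2 := by
    rw [le_div_iff₀ (by linarith)] at hRρ
    have h3 : 1 ≤ R * s := by
      rw [inv_lt_iff_one_lt_mul₀ hR0] at h1
      linarith
    have h4 : 1 ≤ R ^ 2 * s ^ 2 := by
      rw [← mul_pow]
      exact one_le_pow₀ h3
    nlinarith [mul_le_mul_of_nonneg_right hRρ (sq_nonneg s)]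
  -- The circle of radius `s` maps to an ellipse with half axes `A` and `|s - s⁻¹| / 2`. Their ratio
  -- is at most `ρ - 1` exactly when `s ^ 2` and its inverse are at most `ρ / (2 - ρ)`.
  set κ := (s - s⁻¹) / 2 / (ρ - 1) with hκ
  have hκA : κ ^ 2 ≤ A ^ 2 := by
    have e1 : (ρ - 1) * A - (s - s⁻¹) / 2 = (ρ - s ^ 2 * (2 - ρ)) / (2 * s) := by
      rw [hA]
      field_simp
      ring
    have e2 : (ρ - 1) * A + (s - s⁻¹) / 2 = (ρ * s ^ 2 - (2 - ρ)) / (2 * s) := by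
      rw [hA]
      field_simp
      ring
    have e1' : 0 ≤ (ρ - 1) * A - (s - s⁻¹) / 2 := by
      rw [e1]
      exact div_nonneg (by linarith) (by positivity)
    have e2' : 0 ≤ (ρ - 1) * A + (s - s⁻¹) / 2 := by
      rw [e2]
      exact div_nonneg (by linarith) (by positivity)
    refine sq_le_sq' ?_ ?_
    · rw [hκ, le_div_iff₀ (by linarith)]
      linarith
    · rw [hκ, div_le_iff₀ (by linarith)]
      linarith
  rw [openEllipse, Set.mem_ofPred_eq, hre, him, show l * (w.im / s * ((s - s⁻¹) / 2)) / (ρ - 1) = l * (w.im / s * κ) by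
    rw [hκ]; ring]
  have hunit : (w.re / s) ^ 2 + (w.im / s) ^ 2 = 1 := by
    rw [div_pow, div_pow, ← add_div, hsq, div_self (by positivity)]
  have h6 : (w.im / s) ^ 2 * κ ^ 2 ≤ (w.im / s) ^ 2 * A ^ 2 :=
    mul_le_mul_of_nonneg_left hκA (sq_nonneg _)
  have h7 : (l * A) ^ 2 < c ^ 2 := pow_lt_pow_left₀ hAlt (by positivity) two_ne_zero
  have h8 : (l * (w.re / s * A)) ^ 2 + (l * (w.im / s * κ)) ^ 2 ≤ (l * A) ^ 2 := by
    calc _ = l ^ 2 * ((w.re / s) ^ 2 * A ^ 2 + (w.im / s) ^ 2 * κ ^ 2) := by ring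
      _ ≤ l ^ 2 * ((w.re / s) ^ 2 * A ^ 2 + (w.im / s) ^ 2 * A ^ 2) := by gcongr
      _ = l ^ 2 * A ^ 2 * ((w.re / s) ^ 2 + (w.im / s) ^ 2) := by ring
      _ = _ := by rw [hunit]; ring
  nlinarith

/-! ### Boundedness of the extension up to the branch point -/

/-- The closure of the smaller ellipse meets the boundary of the larger one only at `0`. Outside a
ball around `0` it is therefore a compact subset of the larger ellipse. -/
lemma exists_bound_openEllipse {κ c d δ B : ℝ} (hκ : 0 < κ) (hc : 0 < c) (hcd : c < d) (hδ : 0 < δ)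
    {F : ℂ → ℂ} (hF : ContinuousOn F (openEllipse κ d))
    (hB : ∀ z ∈ openEllipse κ d, ‖z‖ < δ → ‖F z‖ ≤ B) :
    ∃ B', ∀ z ∈ openEllipse κ c, ‖F z‖ ≤ B' := by
  set K : Set ℂ := {z : ℂ | z.re ^ 2 + (z.im / κ) ^ 2 ≤ 2 * c * z.re} ∩ {z : ℂ | δ ≤ ‖z‖} with hK
  have hKc : IsCompact K := by
    refine Metric.isCompact_of_isClosed_isBounded
      ((isClosed_le (by fun_prop) (by fun_prop)).inter (isClosed_le (by fun_prop) (by fun_prop))) ?_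
    refine isBounded_iff_forall_norm_le.2 ⟨2 * c + κ * (2 * c), fun z hz => ?_⟩
    have hz' : z.re ^ 2 + (z.im / κ) ^ 2 ≤ 2 * c * z.re := hz.1
    have h0 : 0 ≤ z.re := by
      by_contra! h
      nlinarith [sq_nonneg z.re, sq_nonneg (z.im / κ)]
    have h1 : z.re ≤ 2 * c := by
      by_contra! h
      nlinarith [sq_nonneg (z.im / κ)]
    have h2 : |z.im / κ| ≤ 2 * c := abs_le_of_sq_le_sq (by nlinarith [sq_nonneg z.re]) (by linarith)
    rw [abs_div, abs_of_pos hκ, div_le_iff₀ hκ] at h2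
    refine (Complex.norm_le_abs_re_add_abs_im z).trans ?_
    rw [abs_of_nonneg h0]
    linarith
  have hKd : K ⊆ openEllipse κ d := by
    intro z hz
    have hz' : z.re ^ 2 + (z.im / κ) ^ 2 ≤ 2 * c * z.re := hz.1
    have hz0 : z ≠ 0 := norm_pos_iff.1 (hδ.trans_le hz.2)
    have h0 : 0 < z.re := by
      by_contra! h
      have h1 : z.re = 0 := by nlinarith [sq_nonneg z.re, sq_nonneg (z.im / κ)]
      rw [h1] at hz'
      have h2 : z.im / κ = 0 := by nlinarith [sq_nonneg (z.im / κ)]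
      rw [div_eq_zero_iff, or_iff_left hκ.ne'] at h2
      exact hz0 (Complex.ext h1 h2)
    show z.re ^ 2 + (z.im / κ) ^ 2 < 2 * d * z.re
    nlinarith
  obtain ⟨B', hB'⟩ := hKc.exists_bound_of_continuousOn (hF.mono hKd)
  refine ⟨max B B', fun z hz => ?_⟩
  rcases lt_or_ge ‖z‖ δ with hlt | hge
  · exact (hB z (openEllipse_mono hc hcd.le hz) hlt).trans (le_max_left _ _)
  · have hz' : z.re ^ 2 + (z.im / κ) ^ 2 < 2 * c * z.re := hz
    exact (hB' z ⟨hz'.le, hge⟩).trans (le_max_right _ _)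

/-- The real power series is summed at complex arguments. Taking `δ` strictly below its radius makes
the norms summable, which gives boundedness as well as holomorphy. -/
lemma exists_complex_extension {f : ℝ → ℂ} {s : Set ℝ} (hf : AnalyticWithinAt ℝ f s 0) :
    ∃ δ > 0, ∃ g : ℂ → ℂ, DifferentiableOn ℂ g (Metric.ball 0 δ) ∧
      (∃ B, ∀ z ∈ Metric.ball (0 : ℂ) δ, ‖g z‖ ≤ B) ∧
      ∀ t ∈ s, |t| < δ → g t = f t := by
  obtain ⟨q, r, hq⟩ := hf
  obtain ⟨δ, hδ0, hδr⟩ := ENNReal.lt_iff_exists_nnreal_btwn.1 hq.r_pos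
  have hδ : 0 < (δ : ℝ) := by exact_mod_cast hδ0
  have hsum := q.summable_norm_mul_pow (hδr.trans_le hq.r_le)
  have hb : ∀ n : ℕ, ∀ z ∈ Metric.ball (0 : ℂ) δ, ‖z ^ n * q.coeff n‖ ≤ ‖q n‖ * (δ : ℝ) ^ n := by
    intro n z hz
    rw [norm_mul, norm_pow, mul_comm, q.norm_apply_eq_norm_coef]
    have : ‖z‖ ≤ δ := le_of_lt (by simpa using hz)
    gcongr
  refine ⟨δ, hδ, fun z => ∑' n, z ^ n * q.coeff n,
    Complex.differentiableOn_tsum_of_summable_norm hsum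
      (fun n => ((differentiable_id.pow n).mul_const _).differentiableOn) Metric.isOpen_ball hb,
    ⟨∑' n, ‖q n‖ * (δ : ℝ) ^ n, fun z hz => tsum_of_norm_bounded hsum.hasSum fun n => hb n z hz⟩,
    fun t ht htδ => ?_⟩
  have h := hq.hasSum (y := t) (by simpa using Or.inr ht) (by
    rw [Metric.mem_eball, edist_dist]
    refine lt_trans ?_ hδr
    rw [← ENNReal.ofReal_coe_nnreal, ENNReal.ofReal_lt_ofReal_iff hδ]
    simpa using htδ)
  rw [zero_add] at h
  rw [← h.tsum_eq]
  refine tsum_congr fun n => ?_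
  rw [q.apply_eq_pow_smul_coeff, Complex.real_smul]
  push_cast
  rfl

lemma norm_cpow_half (z : ℂ) : ‖z ^ (1 / 2 : ℂ)‖ ^ 2 = ‖z‖ := by
  rw [← norm_pow, ← Complex.cpow_nat_mul]
  norm_num

/-- A holomorphic extension of `ξ₁ + √t * ξ₂` to an ellipse with vertex `0` is bounded near `0`. -/
lemma exists_bound_near_zero {κ h : ℝ} (hh : 0 < h) {ξ ξ₁ ξ₂ : ℝ → ℂ} {F : ℂ → ℂ}
    (hξ₁ : AnalyticWithinAt ℝ ξ₁ (Set.Icc 0 h) 0) (hξ₂ : AnalyticWithinAt ℝ ξ₂ (Set.Icc 0 h) 0)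
    (hξ : ∀ t ∈ Set.Icc 0 h, ξ t = ξ₁ t + (Real.sqrt t : ℂ) * ξ₂ t)
    (hF : AnalyticOnNhd ℂ F (openEllipse κ h)) (hFξ : ∀ t ∈ Set.Ioc 0 h, F (t : ℂ) = ξ t) :
    ∃ δ > 0, ∃ B, ∀ z ∈ openEllipse κ h, ‖z‖ < δ → ‖F z‖ ≤ B := by
  obtain ⟨δ₁, hδ₁, g₁, hg₁, ⟨B₁, hB₁⟩, he₁⟩ := exists_complex_extension hξ₁
  obtain ⟨δ₂, hδ₂, g₂, hg₂, ⟨B₂, hB₂⟩, he₂⟩ := exists_complex_extension hξ₂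
  -- The `1` bounds the square root by `1`; the `h` keeps the real points up to `δ` inside the
  -- ellipse and the domain of `ξ`.
  set δ := min 1 (min h (min δ₁ δ₂)) with hδdef
  have hδ : 0 < δ := by positivity
  have hδ1 : δ ≤ 1 := min_le_left _ _
  have hδh : δ ≤ h := (min_le_right _ _).trans (min_le_left _ _)
  have hδδ₁ : δ ≤ δ₁ := (min_le_right _ _).trans ((min_le_right _ _).trans (min_le_left _ _))
  have hδδ₂ : δ ≤ δ₂ := (min_le_right _ _).trans ((min_le_right _ _).trans (min_le_right _ _))
  set U := openEllipse κ h ∩ Metric.ball (0 : ℂ) δ with hU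
  have hUo : IsOpen U := (isOpen_openEllipse κ h).inter Metric.isOpen_ball
  have hUc : IsPreconnected U :=
    ((convex_openEllipse κ h).inter (convex_ball 0 δ)).isPreconnected
  -- The ellipse lies in the right half plane, where the principal root is holomorphic. The identity
  -- theorem on the convex set `U` then turns agreement on a real segment into `F = G`.
  set G : ℂ → ℂ := fun z => g₁ z + z ^ (1 / 2 : ℂ) * g₂ z with hG
  have hGd : DifferentiableOn ℂ G U := by
    refine (hg₁.mono fun z hz => Metric.ball_subset_ball hδδ₁ hz.2).add
      (DifferentiableOn.mul ?_ (hg₂.mono fun z hz => Metric.ball_subset_ball hδδ₂ hz.2))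
    intro z hz
    exact (differentiableAt_id.cpow_const
      (Or.inl (openEllipse_re_pos hh hz.1))).differentiableWithinAt
  have hreal : ∀ t ∈ Set.Ioo 0 δ, (t : ℂ) ∈ U ∧ F t = G t := by
    intro t ht
    have htI : t ∈ Set.Icc 0 h := ⟨ht.1.le, ht.2.le.trans hδh⟩
    refine ⟨⟨?_, ?_⟩, ?_⟩
    · show (t : ℂ).re ^ 2 + ((t : ℂ).im / κ) ^ 2 < 2 * h * (t : ℂ).re
      simp only [Complex.ofReal_re, Complex.ofReal_im, zero_div]
      nlinarith [ht.1, ht.2]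
    · simpa [abs_of_pos ht.1] using ht.2
    · have hs : (t : ℂ) ^ (1 / 2 : ℂ) = (Real.sqrt t : ℂ) := by
        rw [Real.sqrt_eq_rpow, Complex.ofReal_cpow ht.1.le]
        norm_num
      have habs : |t| < δ := by rw [abs_of_pos ht.1]; exact ht.2
      rw [hFξ t ⟨ht.1, htI.2⟩, hξ t htI, hG]
      simp only
      rw [hs, he₁ t htI (habs.trans_le hδδ₁), he₂ t htI (habs.trans_le hδδ₂)]
  have hmid : δ / 2 ∈ Set.Ioo 0 δ := ⟨by linarith, by linarith⟩
  have hfreq : ∃ᶠ z in nhdsWithin ((δ / 2 : ℝ) : ℂ) {((δ / 2 : ℝ) : ℂ)}ᶜ, F z = G z := by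
    have ht : Filter.Tendsto (fun t : ℝ => (t : ℂ)) (nhdsWithin (δ / 2) {δ / 2}ᶜ)
        (nhdsWithin ((δ / 2 : ℝ) : ℂ) {((δ / 2 : ℝ) : ℂ)}ᶜ) := by
      refine tendsto_nhdsWithin_of_tendsto_nhds_of_eventually_within _
        (Complex.continuous_ofReal.continuousAt.tendsto.mono_left nhdsWithin_le_nhds) ?_
      filter_upwards [self_mem_nhdsWithin] with t ht htt
      exact ht (Complex.ofReal_injective htt)
    refine ht.frequently (Filter.Eventually.frequently ?_)
    filter_upwards [nhdsWithin_le_nhds (Ioo_mem_nhds hmid.1 hmid.2)] with t ht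
    exact (hreal t ht).2
  have hEq := (hF.mono Set.inter_subset_left).eqOn_of_preconnected_of_frequently_eq
    (hGd.analyticOnNhd hUo) hUc (hreal _ hmid).1 hfreq
  refine ⟨δ, hδ, B₁ + B₂, fun z hz hzδ => ?_⟩
  have hzb : z ∈ Metric.ball (0 : ℂ) δ := by simpa using hzδ
  have h1 := hB₁ z (Metric.ball_subset_ball hδδ₁ hzb)
  have h2 := hB₂ z (Metric.ball_subset_ball hδδ₂ hzb)
  have h3 : ‖z ^ (1 / 2 : ℂ)‖ ≤ 1 := by
    have := norm_cpow_half z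
    by_contra! hlt
    nlinarith
  rw [hEq ⟨hz, hzb⟩, hG]
  refine (norm_add_le _ _).trans (add_le_add h1 ?_)
  rw [norm_mul]
  exact (mul_le_of_le_one_left (norm_nonneg _) h3).trans h2

/-! ### Trapezoidal rule on the interval at `0` -/

/-- A function of the form `ξ₁ + √t * ξ₂` is Hölder continuous at `0` with exponent `1 / 2`. -/
lemma exists_norm_sub_le_sqrt {h : ℝ} {ξ ξ₁ ξ₂ : ℝ → ℂ} (hh : 0 < h)
    (hξ₁ : AnalyticOn ℝ ξ₁ (Set.Icc 0 h)) (hξ₂ : AnalyticOn ℝ ξ₂ (Set.Icc 0 h))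
    (hξ : ∀ t ∈ Set.Icc 0 h, ξ t = ξ₁ t + (Real.sqrt t : ℂ) * ξ₂ t) :
    ∃ L, 0 ≤ L ∧ ∀ t ∈ Set.Icc 0 h, ‖ξ t - ξ 0‖ ≤ L * Real.sqrt t := by
  obtain ⟨K, hK⟩ := (hξ₁.contDiffOn (n := 1) (uniqueDiffOn_Icc hh)).exists_lipschitzOnWith
    one_ne_zero (convex_Icc 0 h) isCompact_Icc
  obtain ⟨B, hB⟩ := isCompact_Icc.exists_bound_of_continuousOn hξ₂.continuousOn
  have h0 : (0 : ℝ) ∈ Set.Icc 0 h := Set.left_mem_Icc.2 hh.le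
  have hB0 : 0 ≤ B := (norm_nonneg _).trans (hB 0 h0)
  refine ⟨K * Real.sqrt h + B, by positivity, fun t ht => ?_⟩
  have e : ξ t - ξ 0 = (ξ₁ t - ξ₁ 0) + (Real.sqrt t : ℂ) * ξ₂ t := by
    rw [hξ t ht, hξ 0 h0]
    simp
    ring
  have h1 : ‖ξ₁ t - ξ₁ 0‖ ≤ K * (Real.sqrt h * Real.sqrt t) := by
    refine (hK.norm_sub_le ht h0).trans ?_
    rw [sub_zero, Real.norm_of_nonneg ht.1]
    gcongr
    calc t = Real.sqrt t * Real.sqrt t := (Real.mul_self_sqrt ht.1).symm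
      _ ≤ _ := by
        gcongr
        exact ht.2
  have h2 : ‖(Real.sqrt t : ℂ) * ξ₂ t‖ ≤ Real.sqrt t * B := by
    rw [norm_mul, Complex.norm_real, Real.norm_of_nonneg (Real.sqrt_nonneg t)]
    exact mul_le_mul_of_nonneg_left (hB t ht) (Real.sqrt_nonneg t)
  rw [e]
  refine (norm_add_le _ _).trans ?_
  linarith

/-- The rule is exact for the constant `f 0`. After subtracting it, integral and endpoint term
contribute at most `L` and `L / 2` times `ε ^ (3 / 2)`. -/
lemma norm_integral_sub_trapezoidalRule_le {ε L : ℝ} (hε : 0 < ε) {f : ℝ → ℂ}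
    (hf : ContinuousOn f (Set.Icc 0 ε)) (hL0 : 0 ≤ L)
    (hL : ∀ t ∈ Set.Icc 0 ε, ‖f t - f 0‖ ≤ L * Real.sqrt t) :
    ‖(∫ t in (0 : ℝ)..ε, f t) - trapezoidalRule 0 ε f‖ ≤ 2 * L * ε ^ (3 / 2 : ℝ) := by
  have hfi : IntervalIntegrable f MeasureTheory.volume 0 ε :=
    ContinuousOn.intervalIntegrable (by rwa [Set.uIcc_of_le hε.le])
  have e : (∫ t in (0 : ℝ)..ε, f t) - trapezoidalRule 0 ε f =
      (∫ t in (0 : ℝ)..ε, (f t - f 0)) - ((ε / 2 : ℝ) : ℂ) * (f ε - f 0) := by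
    rw [intervalIntegral.integral_sub hfi intervalIntegrable_const,
      intervalIntegral.integral_const, trapezoidalRule, Complex.real_smul]
    push_cast
    ring
  have hpow : ε ^ (3 / 2 : ℝ) = Real.sqrt ε * ε := by
    rw [Real.sqrt_eq_rpow]
    nth_rw 3 [← Real.rpow_one ε]
    rw [← Real.rpow_add hε]
    norm_num
  have h1 : ‖∫ t in (0 : ℝ)..ε, (f t - f 0)‖ ≤ L * Real.sqrt ε * |ε - 0| := by
    refine intervalIntegral.norm_integral_le_of_norm_le_const fun t ht => ?_
    rw [Set.uIoc_of_le hε.le] at ht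
    refine (hL t ⟨ht.1.le, ht.2⟩).trans ?_
    gcongr
    exact ht.2
  have h2 : ‖((ε / 2 : ℝ) : ℂ) * (f ε - f 0)‖ ≤ ε / 2 * (L * Real.sqrt ε) := by
    rw [norm_mul, Complex.norm_real, Real.norm_of_nonneg (by positivity)]
    exact mul_le_mul_of_nonneg_left (hL ε ⟨hε.le, le_rfl⟩) (by positivity)
  rw [sub_zero, abs_of_pos hε] at h1
  rw [e, hpow]
  refine (norm_sub_le _ _).trans ?_
  have : 0 ≤ L * Real.sqrt ε * ε := by positivity
  linarith

/-! ### The graded mesh and the admissible parameter -/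

lemma meshPoint_succ_mem {p h : ℝ} (hh : 0 < h) (hp0 : 0 < p) (hp1 : p < 1) (n : ℕ) :
    meshPoint p h (n + 1) ∈ Set.Ioc 0 h := by
  refine ⟨by simp only [meshPoint]; positivity, ?_⟩
  exact mul_le_of_le_one_left hh.le (pow_le_one₀ hp0.le hp1.le)

lemma integral_eq_add_sum_meshPoint {p h : ℝ} (hh : 0 < h) (hp0 : 0 < p) (hp1 : p < 1) {f : ℝ → ℂ}
    (hf : ContinuousOn f (Set.Icc 0 h)) (N : ℕ) :
    ∫ t in (0 : ℝ)..h, f t = (∫ t in (0 : ℝ)..meshPoint p h (N + 1), f t) +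
      ∑ n ∈ Finset.Icc 1 N, ∫ t in meshPoint p h (n + 1)..meshPoint p h n, f t := by
  have hint : ∀ a ∈ Set.Icc 0 h, ∀ b ∈ Set.Icc 0 h,
      IntervalIntegrable f MeasureTheory.volume a b := fun a ha b hb =>
    (hf.mono (Set.uIcc_subset_Icc ha hb)).intervalIntegrable
  have hm := fun n => Set.Ioc_subset_Icc_self (meshPoint_succ_mem hh hp0 hp1 n)
  induction N with
  | zero => simp [meshPoint]
  | succ N ih =>
    rw [ih, Finset.sum_Icc_succ_top (by omega), ← intervalIntegral.integral_add_adjacent_intervals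
      (hint 0 (Set.left_mem_Icc.2 hh.le) _ (hm (N + 1))) (hint _ (hm (N + 1)) _ (hm N))]
    ring

/-- The parameter of the Bernstein ellipse of the `n`-th panel is small enough for the ellipse not to
reach beyond `0`. -/
lemma one_sub_mul_add_inv_le {p R : ℝ} (hp0 : 0 < p) (hp1 : p < 1) (hR : 1 < R)
    (hRp : R ≤ (1 + Real.sqrt p) / (1 - Real.sqrt p)) :
    (1 - p) / 2 * ((R + R⁻¹) / 2) ≤ (1 + p) / 2 := by
  set q := Real.sqrt p with hq
  have hq0 : 0 < q := Real.sqrt_pos.2 hp0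
  have hqp : q ^ 2 = p := Real.sq_sqrt hp0.le
  have hq1 : q < 1 := by nlinarith
  rw [le_div_iff₀ (by linarith)] at hRp
  -- As a function of `R`, the difference vanishes at `(1 + q) / (1 - q)` and at its reciprocal,
  -- whence the factorization.
  have e : (1 + p) / 2 - (1 - p) / 2 * ((R + R⁻¹) / 2) =
      ((1 + q) - R * (1 - q)) * (R * (1 + q) - (1 - q)) / (4 * R) := by
    rw [← hqp]
    field_simp
    ring
  have : 0 ≤ ((1 + q) - R * (1 - q)) * (R * (1 + q) - (1 - q)) / (4 * R) :=
    div_nonneg (mul_nonneg (by linarith) (by nlinarith)) (by linarith)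
  linarith

lemma one_lt_min_parameter {p ρ : ℝ} (hp0 : 0 < p) (hp1 : p < 1) (hρ1 : 1 < ρ) (hρ2 : ρ < 2) :
    1 < min ((1 + Real.sqrt p) / (1 - Real.sqrt p)) (Real.sqrt (ρ / (2 - ρ))) := by
  have hq0 : 0 < Real.sqrt p := Real.sqrt_pos.2 hp0
  have hq1 : Real.sqrt p < 1 := by
    rw [Real.sqrt_lt' one_pos]
    simpa using hp1
  refine lt_min ?_ ?_
  · rw [lt_div_iff₀ (by linarith)]
    linarith
  · rw [Real.lt_sqrt zero_le_one, lt_div_iff₀ (by linarith)]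
    linarith

end GradedQuadrature
end

/-! ### Assembly of the error bound -/

open GradedQuadrature

theorem mainTheorem4 (h p ρ : ℝ) (hh : 0 < h) (hp0 : 0 < p) (hp1 : p < 1)
    (hρ1 : 1 < ρ) (hρ2 : ρ < 2)
    (ξ ξ₁ ξ₂ : ℝ → ℂ)
    (hξ₁ : AnalyticOn ℝ ξ₁ (Set.Icc 0 h)) (hξ₂ : AnalyticOn ℝ ξ₂ (Set.Icc 0 h))
    (hξ : ∀ t ∈ Set.Icc 0 h, ξ t = ξ₁ t + (Real.sqrt t : ℂ) * ξ₂ t)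
    (hext : ∃ F : ℂ → ℂ,
      AnalyticOnNhd ℂ F (interior (GradedQuadrature.vertexEllipse 0 (2 * h) (ρ * h))) ∧
      ∀ t ∈ Set.Ioc 0 h, F (t : ℂ) = ξ t) :
    ∃ C : ℝ, 0 < C ∧ ∀ N M : ℕ, 1 ≤ N → 1 ≤ M →
      ‖(∫ t in (0 : ℝ)..h, ξ t) - GradedQuadrature.compositeRule p h N M ξ‖ ≤
        C * (N : ℝ) *
            (min ((1 + Real.sqrt p) / (1 - Real.sqrt p)) (Real.sqrt (ρ / (2 - ρ)))) ^
              (-(2 * (M : ℤ))) +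
          C * (p ^ N * h) ^ (3 / 2 : ℝ) := by

  obtain ⟨F, hF, hFξ⟩ := hext
  set R := min ((1 + Real.sqrt p) / (1 - Real.sqrt p)) (Real.sqrt (ρ / (2 - ρ))) with hRdef
  have hR : 1 < R := one_lt_min_parameter hp0 hp1 hρ1 hρ2
  have hR0 : 0 < R := zero_lt_one.trans hR
  have hRρ : R ^ 2 ≤ ρ / (2 - ρ) := by
    rw [← Real.le_sqrt' hR0]
    exact min_le_right _ _
  have hF' : AnalyticOnNhd ℂ F (openEllipse (ρ - 1) h) :=
    hF.mono (openEllipse_subset_interior_vertexEllipse hh hρ1)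
  have h0 : (0 : ℝ) ∈ Set.Icc 0 h := Set.left_mem_Icc.2 hh.le
  obtain ⟨δ, hδ, B₀, hB₀⟩ := exists_bound_near_zero hh (hξ₁ 0 h0) (hξ₂ 0 h0) hξ hF' hFξ
  -- The midpoint of the largest panel `[p * h, h]`. It is strictly below `h`, so the ellipse with
  -- this center containing all panel ellipses is one on which `F` is bounded.
  set c₁ := (1 + p) / 2 * h with hc₁
  have hc₁0 : 0 < c₁ := by positivity
  obtain ⟨B, hB⟩ := exists_bound_openEllipse (by linarith) hc₁0
    (show c₁ < h by rw [hc₁]; nlinarith) hδ hF'.continuousOn hB₀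
  have hB0 : 0 ≤ B := by
    refine (norm_nonneg _).trans (hB (c₁ : ℂ) ?_)
    show (c₁ : ℂ).re ^ 2 + ((c₁ : ℂ).im / (ρ - 1)) ^ 2 < 2 * c₁ * (c₁ : ℂ).re
    simp only [Complex.ofReal_re, Complex.ofReal_im, zero_div]
    nlinarith
  obtain ⟨L, hL0, hL⟩ := exists_norm_sub_le_sqrt hh hξ₁ hξ₂ hξ
  have hcont : ContinuousOn ξ (Set.Icc 0 h) :=
    (hξ₁.continuousOn.add ((Complex.continuous_ofReal.comp Real.continuous_sqrt).continuousOn.mul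
      hξ₂.continuousOn)).congr hξ
  have hR1 : 0 < 1 - R⁻¹ := sub_pos.2 (inv_lt_one_of_one_lt₀ hR)
  set D := 4 * (2 * B / (1 - R⁻¹)) with hD
  have hD0 : 0 ≤ D := by positivity
  -- The summand `1` only makes the constant positive.
  refine ⟨h * D + 2 * L + 1, by positivity, fun N M _ hM => ?_⟩
  have hpanel : ∀ n ∈ Finset.Icc 1 N,
      ‖(∫ t in meshPoint p h (n + 1)..meshPoint p h n, ξ t) -
        gaussRule M (meshPoint p h (n + 1)) (meshPoint p h n) ξ‖ ≤ h * D * R⁻¹ ^ (2 * M) := by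
    intro n hn
    obtain ⟨k, rfl⟩ : ∃ k, n = k + 1 := ⟨n - 1, by grind⟩
    set d := p ^ k * h with hd
    have hmk : meshPoint p h (k + 1) = d := rfl
    have hmk' : meshPoint p h (k + 1 + 1) = p * d := by
      simp only [meshPoint, hd]
      ring
    have hd0 : 0 < d := by positivity
    have hdh : d ≤ h := (meshPoint_succ_mem hh hp0 hp1 k).2
    rw [hmk, hmk']
    have hpd : p * d ≤ d := mul_le_of_le_one_left hd0.le hp1.le
    have hpd0 : 0 < p * d := by positivity
    have hsub : ∀ t ∈ Set.Icc (p * d) d, t ∈ Set.Ioc 0 h := fun t ht =>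
      ⟨hpd0.trans_le ht.1, ht.2.trans hdh⟩
    have hmem : ∀ w : ℂ, R⁻¹ < ‖w‖ → ‖w‖ < R →
        (((d - p * d) / 2 : ℝ) : ℂ) * ((w + w⁻¹) / 2) + ((d + p * d) / 2 : ℝ) ∈
          openEllipse (ρ - 1) c₁ := by
      intro w h1 h2
      have hl : (d - p * d) / 2 * ((R + R⁻¹) / 2) ≤ (d + p * d) / 2 := by
        have := mul_le_mul_of_nonneg_right
          (one_sub_mul_add_inv_le hp0 hp1 hR (min_le_left _ _)) hd0.le
        linarith
      refine openEllipse_mono (by positivity) ?_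
        (joukowski_mem_openEllipse hρ1 hρ2 hR hRρ (by nlinarith) hl h1 h2)
      rw [hc₁]
      nlinarith
    have hbound := norm_integral_sub_gaussRule_le hM hpd
      (hcont.mono fun t ht => Set.Ioc_subset_Icc_self (hsub t ht))
      (fun t ht => hFξ t (hsub t ht)) hR
      (fun w h1 h2 => (hF' _ (openEllipse_mono hc₁0 (by rw [hc₁]; nlinarith)
        (hmem w h1 h2))).differentiableAt)
      (fun w h1 h2 => hB _ (hmem w h1 h2))
    refine hbound.trans ?_
    -- The panel length is estimated by `h`, which discards the decay in `k`; summing equal bounds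
    -- produces the factor `N`.
    calc (d - p * d) / 2 * (4 * (2 * B * R⁻¹ ^ (2 * M) / (1 - R⁻¹)))
        = (d - p * d) / 2 * (D * R⁻¹ ^ (2 * M)) := by rw [hD]; ring
      _ ≤ h * (D * R⁻¹ ^ (2 * M)) := by
        gcongr
        linarith
      _ = _ := by ring
  have hmN := meshPoint_succ_mem hh hp0 hp1 N
  have htrap := norm_integral_sub_trapezoidalRule_le hmN.1
    (hcont.mono (Set.Icc_subset_Icc_right hmN.2)) hL0
    (fun t ht => hL t ⟨ht.1, ht.2.trans hmN.2⟩)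
  have hsplit : (∫ t in (0 : ℝ)..h, ξ t) - compositeRule p h N M ξ =
      ((∫ t in (0 : ℝ)..meshPoint p h (N + 1), ξ t) - trapezoidalRule 0 (meshPoint p h (N + 1)) ξ) +
      ∑ n ∈ Finset.Icc 1 N, ((∫ t in meshPoint p h (n + 1)..meshPoint p h n, ξ t) -
        gaussRule M (meshPoint p h (n + 1)) (meshPoint p h n) ξ) := by
    rw [integral_eq_add_sum_meshPoint hh hp0 hp1 hcont N, compositeRule, Finset.sum_sub_distrib,
      show meshPoint p h 0 = 0 from rfl]
    ring
  have hsum := norm_sum_le_of_le _ hpanel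
  rw [Finset.sum_const, Nat.card_Icc, Nat.add_sub_cancel, nsmul_eq_mul] at hsum
  have hz : R ^ (-(2 * (M : ℤ))) = R⁻¹ ^ (2 * M) := by
    rw [zpow_neg, inv_pow]
    norm_cast
  have hε : 0 ≤ (p ^ N * h) ^ (3 / 2 : ℝ) := by positivity
  have hE : 0 ≤ (N : ℝ) * R⁻¹ ^ (2 * M) := by positivity
  rw [hsplit, hz]
  refine (norm_add_le _ _).trans ((add_le_add htrap hsum).trans ?_)
  rw [show meshPoint p h (N + 1) = p ^ N * h from rfl]
  have h1 : 0 ≤ (2 * L + 1) * ((N : ℝ) * R⁻¹ ^ (2 * M)) := by positivity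
  have h2 : 0 ≤ (h * D + 1) * (p ^ N * h) ^ (3 / 2 : ℝ) := by positivity
  linarith
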